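/- Let $K$ be an algebraically closed field of characteristic zero, let $G$ be a finite abelian group with character group $\hat{G} = \operatorname{Hom}(G, K^\times)$, and let $A$ be a left Yetter-Drinfel'd Hopf algebra over the group ring $H = K[G]$ which is commutative and semisimple as an algebra. Here, a left Yetter-Drinfel'd Hopf algebra over $H$ is a $K$-algebra and $K$-coalgebra $A$ that is a left $H$-module and a left $H$-comodule via $\delta: A \to H \otimes A$, $\delta(a) = a^{(1)} \otimes a^{(2)}$, with $\delta(h.a) = h_{(1)} a^{(1)} S_H(h_{(3)}) \otimes h_{(2)}.a^{(2)}$, such that multiplication, unit, comultiplication and counit are $H$-linear and $H$-colinear, the counit is an algebra homomorphism, the comultiplication is an algebra homomorphism for the product $(a \otimes a')(b \otimes b') = a(a'^{(1)}.b) \otimes a'^{(2)} b'$ on $A \otimes A$, and there is an $H$-linear and colinear antipode $S_A: A \to A$ with $S_A(a_{(1)}) a_{(2)} = a_{(1)} S_A(a_{(2)}) = \varepsilon_A(a) 1_A$ for all $a \in A$. For $g \in G$, let $\phi_g: A \to A$ be the action of $g$, i.e. $\phi_g(a) = g.a$; for $\gamma \in \hat{G}$, let $\psi_\gamma: A \to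 A$, $\psi_\gamma(a) = \gamma(a^{(1)}) a^{(2)}$, where $\gamma$ is extended linearly to $K[G]$. For a primitive idempotent $e \in A$, put $$T_e = \{g \in G \mid \phi_g(e) = e\}, \qquad Q_e = \{\gamma \in \hat{G} \mid \psi_\gamma(e) = e\},$$ $$T_e^\perp = \{\gamma \in \hat{G} \mid \gamma(g) = 1 \text{ for all } g \in T_e\}, \qquad Q_e^\perp = \{g \in G \mid \gamma(g) = 1 \text{ for all } \gamma \in Q_e\}.$$ Then for every primitive idempotent $e \in A$, $$\{\phi_g(e) \mid g \in Q_e^\perp\} = \{\psi_\gamma(e) \mid \gamma \in T_e^\perp\}.$$ -/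

import Mathlib

open scoped TensorProduct

noncomputable section

namespace YetterDrinfeld

section General

variable {K H : Type*} [Field K] [Ring H] [HopfAlgebra K H]
variable {V W : Type*} [AddCommGroup V] [Module K V] [AddCommGroup W] [Module K W]

/-- The linear map `h₁ ⊗ (h₂ ⊗ h₃) ↦ (x ⊗ v ↦ h₁ x S(h₃) ⊗ h₂.v)`, for a linear map
`act : H → End V`. -/
def conjAct (act : H →ₗ[K] Module.End K V) :
    H ⊗[K] (H ⊗[K] H) →ₗ[K] Module.End K (H ⊗[K] V) :=
  TensorProduct.homTensorHomMap (RingHom.id K) H V H V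
    ∘ₗ TensorProduct.map
        (LinearMap.mul' K (Module.End K H)
          ∘ₗ TensorProduct.map (LinearMap.mul K H)
              ((LinearMap.mul K H).flip ∘ₗ HopfAlgebra.antipode K))
        act
    ∘ₗ (TensorProduct.assoc K H H H).symm.toLinearMap
    ∘ₗ (TensorProduct.comm K H H).toLinearMap.lTensor H

/-- The diagonal action `h.(v ⊗ w) = h₁.v ⊗ h₂.w` on a tensor product. -/
def tensorAct (actV : H →ₗ[K] Module.End K V) (actW : H →ₗ[K] Module.End K W) :
    H →ₗ[K] Module.End K (V ⊗[K] W) :=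
  TensorProduct.homTensorHomMap (RingHom.id K) V W V W ∘ₗ TensorProduct.map actV actW
    ∘ₗ Coalgebra.comul

/-- The codiagonal coaction `v ⊗ w ↦ v⁽¹⁾ w⁽¹⁾ ⊗ (v⁽²⁾ ⊗ w⁽²⁾)` on a tensor product. -/
def tensorCoact (coactV : V →ₗ[K] H ⊗[K] V) (coactW : W →ₗ[K] H ⊗[K] W) :
    V ⊗[K] W →ₗ[K] H ⊗[K] (V ⊗[K] W) :=
  (LinearMap.mul' K H).rTensor (V ⊗[K] W)
    ∘ₗ (TensorProduct.tensorTensorTensorComm K H V H W).toLinearMap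
    ∘ₗ TensorProduct.map coactV coactW

/-- The trivial action `h.ξ = ε(h) ξ` on the base field. -/
def trivialAct (K H : Type*) [Field K] [Ring H] [HopfAlgebra K H] : H →ₗ[K] Module.End K K :=
  LinearMap.mul K K ∘ₗ Coalgebra.counit

/-- The trivial coaction `ξ ↦ 1 ⊗ ξ` on the base field. -/
def trivialCoact (K H : Type*) [Field K] [Ring H] [HopfAlgebra K H] : K →ₗ[K] H ⊗[K] K :=
  TensorProduct.mk K H K 1

/-- `f` commutes with the given actions of `H`. -/
def IsHLinear (actV : H →ₗ[K] Module.End K V) (actW : H →ₗ[K] Module.End K W)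
    (f : V →ₗ[K] W) : Prop :=
  ∀ (h : H) (v : V), f (actV h v) = actW h (f v)

/-- `f` commutes with the given coactions of `H`. -/
def IsHColinear (coactV : V →ₗ[K] H ⊗[K] V) (coactW : W →ₗ[K] H ⊗[K] W)
    (f : V →ₗ[K] W) : Prop :=
  ∀ v : V, coactW (f v) = f.lTensor H (coactV v)

/-- The quasisymmetry `V ⊗ W → W ⊗ V`, `v ⊗ w ↦ v⁽¹⁾.w ⊗ v⁽²⁾`, determined by the coaction on
`V` and the action on `W`. -/
def quasisymmetry (coactV : V →ₗ[K] H ⊗[K] V) (actW : H →ₗ[K] Module.End K W) :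
    V ⊗[K] W →ₗ[K] W ⊗[K] V :=
  (TensorProduct.lift actW).rTensor V
    ∘ₗ (TensorProduct.rightComm K H V W).toLinearMap
    ∘ₗ coactV.rTensor W

/-- The multiplication map `(μ_A ⊗ μ_B) ∘ (id_A ⊗ σ_{B,A} ⊗ id_B)` of the algebra `A ⊗̂ B`, so
that `(a ⊗ b)(a' ⊗ b') = a (b⁽¹⁾.a') ⊗ b⁽²⁾ b'`. -/
def braidedMul {A B : Type*} [Ring A] [Algebra K A] [Ring B] [Algebra K B]
    (actA : H →ₗ[K] Module.End K A) (coactB : B →ₗ[K] H ⊗[K] B) :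
    (A ⊗[K] B) ⊗[K] (A ⊗[K] B) →ₗ[K] A ⊗[K] B :=
  TensorProduct.map (LinearMap.mul' K A) (LinearMap.mul' K B)
    ∘ₗ (TensorProduct.assoc K A A (B ⊗[K] B)).symm.toLinearMap
    ∘ₗ ((TensorProduct.assoc K A B B).toLinearMap
        ∘ₗ (quasisymmetry coactB actA).rTensor B
        ∘ₗ (TensorProduct.assoc K B A B).symm.toLinearMap).lTensor A
    ∘ₗ (TensorProduct.assoc K A B (A ⊗[K] B)).toLinearMap

end General

/-- A left-left Yetter-Drinfel'd module structure over the Hopf algebra `H` on the vector space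
`V`: a left `H`-module and left `H`-comodule structure with
`δ(h.v) = h₁ v⁽¹⁾ S(h₃) ⊗ h₂.v⁽²⁾`. -/
structure YDModule (K H V : Type*) [Field K] [Ring H] [HopfAlgebra K H]
    [AddCommGroup V] [Module K V] where
  /-- The left `H`-module structure. -/
  act : H →ₐ[K] Module.End K V
  /-- The left coaction `δ`. -/
  coact : V →ₗ[K] H ⊗[K] V
  coact_coassoc : ∀ v : V,
    TensorProduct.assoc K H H V ((Coalgebra.comul (R := K) (A := H)).rTensor V (coact v)) =
      coact.lTensor H (coact v)
  coact_counit : ∀ v : V,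
    TensorProduct.lid K V ((Coalgebra.counit (R := K) (A := H)).rTensor V (coact v)) = v
  coact_act : ∀ (h : H) (v : V),
    coact (act h v) =
      conjAct act.toLinearMap ((Coalgebra.comul (R := K)).lTensor H (Coalgebra.comul (R := K) h))
        (coact v)

/-- A left Yetter-Drinfel'd Hopf algebra structure over the Hopf algebra `H` on the algebra and
coalgebra `A`. The coproduct is multiplicative with respect to the algebra structure of
`A ⊗̂ A`. -/
structure YDHopfAlgebra (K H A : Type*) [Field K] [Ring H] [HopfAlgebra K H]
    [Ring A] [Algebra K A] [Coalgebra K A] extends YDModule K H A where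
  mul_linear :
    IsHLinear (tensorAct act.toLinearMap act.toLinearMap) act.toLinearMap (LinearMap.mul' K A)
  mul_colinear : IsHColinear (tensorCoact coact coact) coact (LinearMap.mul' K A)
  unit_linear : IsHLinear (trivialAct K H) act.toLinearMap (Algebra.linearMap K A)
  unit_colinear : IsHColinear (trivialCoact K H) coact (Algebra.linearMap K A)
  comul_linear :
    IsHLinear act.toLinearMap (tensorAct act.toLinearMap act.toLinearMap)
      (Coalgebra.comul (R := K) (A := A))
  comul_colinear :
    IsHColinear coact (tensorCoact coact coact) (Coalgebra.comul (R := K) (A := A))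
  counit_linear :
    IsHLinear act.toLinearMap (trivialAct K H) (Coalgebra.counit (R := K) (A := A))
  counit_colinear : IsHColinear coact (trivialCoact K H) (Coalgebra.counit (R := K) (A := A))
  comul_mul : ∀ a b : A,
    Coalgebra.comul (R := K) (a * b) =
      braidedMul act.toLinearMap coact
        (Coalgebra.comul (R := K) a ⊗ₜ[K] Coalgebra.comul (R := K) b)
  comul_one : Coalgebra.comul (R := K) (1 : A) = 1 ⊗ₜ[K] 1
  counit_mul : ∀ a b : A,
    Coalgebra.counit (R := K) (a * b) = Coalgebra.counit (R := K) a * Coalgebra.counit (R := K) b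
  counit_one : Coalgebra.counit (R := K) (1 : A) = 1
  /-- The antipode `S`. -/
  antipode : A →ₗ[K] A
  antipode_linear : IsHLinear act.toLinearMap act.toLinearMap antipode
  antipode_colinear : IsHColinear coact coact antipode
  mul_antipode_left : ∀ a : A,
    LinearMap.mul' K A (antipode.rTensor A (Coalgebra.comul (R := K) a)) =
      algebraMap K A (Coalgebra.counit (R := K) a)
  mul_antipode_right : ∀ a : A,
    LinearMap.mul' K A (antipode.lTensor A (Coalgebra.comul (R := K) a)) =
      algebraMap K A (Coalgebra.counit (R := K) a)

section GroupRing

variable {K G V : Type*} [Field K] [CommGroup G] [AddCommGroup V] [Module K V]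

/-- The representation `g ↦ φ_g` of `G` given by the `K[G]`-module structure. -/
def phi (Y : YDModule K (MonoidAlgebra K G) V) (g : G) : Module.End K V :=
  Y.act (MonoidAlgebra.of K G g)

/-- The linear extension `K[G] → K` of a character of `G`. -/
def charExt (γ : G →* Kˣ) : MonoidAlgebra K G →ₐ[K] K :=
  MonoidAlgebra.lift K K G ((Units.coeHom K).comp γ)

/-- The representation `γ ↦ ψ_γ` of the character group of `G` given by the comodule structure:
`ψ_γ(v) = γ(v⁽¹⁾) v⁽²⁾`. -/
def psi (Y : YDModule K (MonoidAlgebra K G) V) (γ : G →* Kˣ) : Module.End K V :=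
  (TensorProduct.lid K V).toLinearMap ∘ₗ (charExt γ).toLinearMap.rTensor V ∘ₗ Y.coact

theorem phi_one (Y : YDModule K (MonoidAlgebra K G) V) : phi Y 1 = 1 := by
  simp only [phi, map_one]

theorem phi_mul (Y : YDModule K (MonoidAlgebra K G) V) (g h : G) :
    phi Y (g * h) = phi Y g * phi Y h := by
  simp only [phi, map_mul]

theorem psi_one (Y : YDModule K (MonoidAlgebra K G) V) : psi Y 1 = 1 := by
  have h : (charExt (K := K) (1 : G →* Kˣ)).toLinearMap =
      Coalgebra.counit (R := K) (A := MonoidAlgebra K G) := by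
    ext g
    simp [charExt]
  ext v
  simp only [psi, h, LinearMap.comp_apply, LinearEquiv.coe_coe, Module.End.one_apply]
  exact Y.coact_counit v

theorem psi_mul (Y : YDModule K (MonoidAlgebra K G) V) (γ γ' : G →* Kˣ) :
    psi Y (γ * γ') = psi Y γ * psi Y γ' := by
  have h1 : psi Y γ ∘ₗ (TensorProduct.lid K V).toLinearMap
        ∘ₗ (charExt γ').toLinearMap.rTensor V =
      (TensorProduct.lid K V).toLinearMap ∘ₗ
        TensorProduct.map (charExt γ').toLinearMap
          ((TensorProduct.lid K V).toLinearMap ∘ₗ (charExt γ).toLinearMap.rTensor V)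
        ∘ₗ Y.coact.lTensor (MonoidAlgebra K G) := by
    ext g v
    simp [psi]
  have h2 : (TensorProduct.lid K V).toLinearMap ∘ₗ
        (charExt (γ * γ')).toLinearMap.rTensor V =
      (TensorProduct.lid K V).toLinearMap ∘ₗ
        TensorProduct.map (charExt γ').toLinearMap
          ((TensorProduct.lid K V).toLinearMap ∘ₗ (charExt γ).toLinearMap.rTensor V)
        ∘ₗ (TensorProduct.assoc K _ _ V).toLinearMap
        ∘ₗ (Coalgebra.comul (R := K) (A := MonoidAlgebra K G)).rTensor V := by
    ext g v
    simp [charExt, mul_smul]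
  ext v
  have e1 := LinearMap.congr_fun h1 (Y.coact v)
  have e2 := LinearMap.congr_fun h2 (Y.coact v)
  simp only [LinearMap.comp_apply, LinearEquiv.coe_coe] at e1 e2
  rw [Y.coact_coassoc v, ← e1] at e2
  exact e2

/-- The inertia group `{g ∈ G | φ_g(e) = e}`. -/
def inertiaGroup (Y : YDModule K (MonoidAlgebra K G) V) (e : V) : Subgroup G where
  carrier := {g | phi Y g e = e}
  one_mem' := by simp [phi_one]
  mul_mem' := by
    intro g h hg hh
    simp only [Set.mem_ofPred_eq] at hg hh ⊢
    rw [phi_mul, Module.End.mul_apply, hh, hg]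
  inv_mem' := by
    intro g hg
    simp only [Set.mem_ofPred_eq] at hg ⊢
    conv_lhs => rw [← hg]
    rw [← Module.End.mul_apply, ← phi_mul, inv_mul_cancel, phi_one, Module.End.one_apply]

/-- The isotropy group `{γ ∈ Ĝ | ψ_γ(e) = e}`. -/
def isotropyGroup (Y : YDModule K (MonoidAlgebra K G) V) (e : V) : Subgroup (G →* Kˣ) where
  carrier := {γ | psi Y γ e = e}
  one_mem' := by simp [psi_one]
  mul_mem' := by
    intro g h hg hh
    simp only [Set.mem_ofPred_eq] at hg hh ⊢
    rw [psi_mul, Module.End.mul_apply, hh, hg]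
  inv_mem' := by
    intro g hg
    simp only [Set.mem_ofPred_eq] at hg ⊢
    conv_lhs => rw [← hg]
    rw [← Module.End.mul_apply, ← psi_mul, inv_mul_cancel, psi_one, Module.End.one_apply]

/-- `T^⊥ = {γ ∈ Ĝ | γ(g) = 1 for all g ∈ T}` for a subgroup `T` of `G`. -/
def charPerp (K : Type*) [Field K] {G : Type*} [CommGroup G] (T : Subgroup G) :
    Subgroup (G →* Kˣ) where
  carrier := {γ | ∀ g ∈ T, γ g = 1}
  one_mem' := by simp
  mul_mem' := by
    intro a b ha hb g hg
    simp [ha g hg, hb g hg]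
  inv_mem' := by
    intro a ha g hg
    simp [ha g hg]

/-- `Q^⊥ = {g ∈ G | γ(g) = 1 for all γ ∈ Q}` for a subgroup `Q` of the character group. -/
def groupPerp (Q : Subgroup (G →* Kˣ)) : Subgroup G where
  carrier := {g | ∀ γ ∈ Q, γ g = 1}
  one_mem' := by simp
  mul_mem' := by
    intro a b ha hb γ hγ
    simp [ha γ hγ, hb γ hγ]
  inv_mem' := by
    intro a ha γ hγ
    simp [ha γ hγ]

end GroupRing

/-- A primitive idempotent: a nonzero idempotent that is not the sum of two nonzero orthogonal
idempotents. -/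
def IsPrimitiveIdempotent {A : Type*} [Ring A] (e : A) : Prop :=
  e ≠ 0 ∧ IsIdempotentElem e ∧
    ∀ f f' : A, IsIdempotentElem f → IsIdempotentElem f' → f * f' = 0 → f' * f = 0 →
      e = f + f' → f = 0 ∨ f' = 0

end YetterDrinfeld

end

/-!
The coaction of `K[G]` decomposes `A` into homogeneous components, with projections `π_g`, and
`ψ_γ = ∑ g, γ(g) π_g`. The maps `φ_g` and `ψ_γ` are algebra automorphisms, so they permute
the primitive idempotents, and distinct primitive idempotents are orthogonal.

The key fact (`twisted_mul_comm`) is that the twisted product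
`a * b = (a⁽¹⁾.b) a⁽²⁾ = ∑ g, φ_g(b) π_g(a)` on `A` is commutative. The antipode satisfies
`S(ab) = S(a) * S(b)` (`antipode_mul`), where `ab = ba`, so it suffices that `S` is surjective. As `A`
is semisimple, it contains an integral `Λ` with `ε(Λ) = 1`, and in the braided algebra `A ⊗̂ A` one has
`(1 ⊗ a) Δ(Λ) = (S(a) ⊗ 1) Δ(Λ)` (`rightOp_comul_integral`). This identity gives the formula for
`S(ab)`, the injectivity of `S`, and the finite-dimensionality of `A`,
which is the ideal spanned by the second tensor factors of `Δ(Λ)`.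

By Fourier inversion on `G`, `|G| (a * b) = ∑ g, ∑ γ, γ(g)⁻¹ φ_g(b) ψ_γ(a)`. Write `T` and `Q` for the
inertia and isotropy group of `e`. If `k ∈ Q^⊥`, the coefficient of `e` in `|G| (e * φ_k(e))` is
`∑ t ∈ T, ∑ q ∈ Q, q(t)⁻¹ = |Q| |T ∩ Q^⊥| ≠ 0`. In `|G| (φ_k(e) * e)` this coefficient is the sum of
`∑ t ∈ T, γ(t)⁻¹` over the `γ` with `ψ_γ(φ_k(e)) = e`, and it vanishes unless one of these `γ` lies in
`T^⊥`. Hence `φ_k(e)` is in the `T^⊥`-orbit of `e` (`exists_psi_eq_phi`); the other inclusion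
(`exists_phi_eq_psi`) is dual.
-/

noncomputable section

namespace YetterDrinfeld

/-! ### Homogeneous components of a comodule over a group ring -/

section Grading

variable {K G V : Type*} [Field K] [CommGroup G] [AddCommGroup V] [Module K V]

/-- The coefficient functional `K[G] → K` at `g ∈ G`. -/
def coeffAt (K : Type*) {G : Type*} [Field K] (g : G) : MonoidAlgebra K G →ₗ[K] K :=
  Finsupp.lapply g ∘ₗ (MonoidAlgebra.coeffLinearEquiv K).toLinearMap

theorem coeffAt_single {G : Type*} [DecidableEq G] (g h : G) (c : K) :
    coeffAt K g (MonoidAlgebra.single h c) = if h = g then c else 0 := by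
  simp [coeffAt, Finsupp.single_apply]

/-- The projection `π_g` of a `K[G]`-comodule onto its homogeneous component of degree `g`, so
that `δ(v) = ∑ g, g ⊗ π_g(v)`. -/
def proj (Y : YDModule K (MonoidAlgebra K G) V) (g : G) : Module.End K V :=
  (TensorProduct.lid K V).toLinearMap ∘ₗ (coeffAt K g).rTensor V ∘ₗ Y.coact

theorem coact_eq_sum [Fintype G] (Y : YDModule K (MonoidAlgebra K G) V) (v : V) :
    Y.coact v = ∑ g, MonoidAlgebra.single g (1 : K) ⊗ₜ[K] proj Y g v := by
  classical
  have h : ∑ g : G, (TensorProduct.mk K _ V (MonoidAlgebra.single g (1 : K))) ∘ₗ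
      (TensorProduct.lid K V).toLinearMap ∘ₗ (coeffAt K g).rTensor V = LinearMap.id := by
    ext g v
    simp [coeffAt_single, TensorProduct.tmul_ite, ite_smul]
  have := LinearMap.congr_fun h (Y.coact v)
  simpa [proj] using this.symm

theorem lid_coeffAt_sum {G : Type*} [Fintype G] (g : G) (f : G → V) :
    TensorProduct.lid K V ((coeffAt K g).rTensor V
      (∑ h, MonoidAlgebra.single h (1 : K) ⊗ₜ[K] f h)) = f g := by
  classical
  simp [coeffAt_single, ite_smul]

theorem sum_proj [Fintype G] (Y : YDModule K (MonoidAlgebra K G) V) (v : V) :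
    ∑ g, proj Y g v = v := by
  have := Y.coact_counit v
  rw [coact_eq_sum] at this
  simpa using this

theorem psi_eq_sum [Fintype G] (Y : YDModule K (MonoidAlgebra K G) V) (γ : G →* Kˣ) (v : V) :
    psi Y γ v = ∑ g, (γ g : K) • proj Y g v := by
  simp [psi, coact_eq_sum, charExt]

theorem proj_proj [Fintype G] [DecidableEq G] (Y : YDModule K (MonoidAlgebra K G) V) (g h : G)
    (v : V) : proj Y g (proj Y h v) = if h = g then proj Y g v else 0 := by
  have h1 := Y.coact_coassoc v
  rw [coact_eq_sum] at h1
  simp only [map_sum, LinearMap.rTensor_tmul, LinearMap.lTensor_tmul,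
    MonoidAlgebra.comul_single, CommSemiring.comul_apply, TensorProduct.map_tmul,
    MonoidAlgebra.lsingle_apply, TensorProduct.assoc_tmul] at h1
  have h2 := congrArg (fun t => TensorProduct.lid K V ((coeffAt K g).rTensor V
    (TensorProduct.lid K _ ((coeffAt K h).rTensor _ t)))) h1
  simp only [map_sum, LinearMap.rTensor_tmul, TensorProduct.lid_tmul, coeffAt_single, ite_smul,
    one_smul, zero_smul, Finset.sum_ite_eq', Finset.mem_univ, if_true] at h2
  have h3 : proj Y g (proj Y h v) = TensorProduct.lid K V ((coeffAt K g).rTensor V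
      (Y.coact (proj Y h v))) := rfl
  rw [h3, ← h2]
  by_cases hh : h = g
  · subst hh; simp
  · simp [hh]

theorem phi_inv_apply (Y : YDModule K (MonoidAlgebra K G) V) (g : G) (v : V) :
    phi Y g⁻¹ (phi Y g v) = v := by
  rw [← Module.End.mul_apply, ← phi_mul, inv_mul_cancel, phi_one, Module.End.one_apply]

theorem phi_apply_inv (Y : YDModule K (MonoidAlgebra K G) V) (g : G) (v : V) :
    phi Y g (phi Y g⁻¹ v) = v := by
  rw [← Module.End.mul_apply, ← phi_mul, mul_inv_cancel, phi_one, Module.End.one_apply]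

theorem psi_inv_apply (Y : YDModule K (MonoidAlgebra K G) V) (γ : G →* Kˣ) (v : V) :
    psi Y γ⁻¹ (psi Y γ v) = v := by
  rw [← Module.End.mul_apply, ← psi_mul, show γ⁻¹ * γ = 1 from inv_mul_cancel γ, psi_one,
    Module.End.one_apply]

theorem psi_apply_inv (Y : YDModule K (MonoidAlgebra K G) V) (γ : G →* Kˣ) (v : V) :
    psi Y γ (psi Y γ⁻¹ v) = v := by
  rw [← Module.End.mul_apply, ← psi_mul, show γ * γ⁻¹ = 1 from mul_inv_cancel γ, psi_one,
    Module.End.one_apply]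

end Grading

/-! ### Compatibility of the action and the grading with the algebra structure -/

section HopfAlgebra

variable {K G A : Type*} [Field K] [CommGroup G] [Ring A] [Algebra K A] [Coalgebra K A]
variable (Y : YDHopfAlgebra K (MonoidAlgebra K G) A)

theorem phi_map_mul (g : G) (a b : A) :
    phi Y.toYDModule g (a * b) = phi Y.toYDModule g a * phi Y.toYDModule g b := by
  have := Y.mul_linear (MonoidAlgebra.of K G g) (a ⊗ₜ b)
  simpa [tensorAct, phi] using this.symm

theorem proj_map_mul [Fintype G] (g : G) (a b : A) :
    proj Y.toYDModule g (a * b) =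
      ∑ h, proj Y.toYDModule h a * proj Y.toYDModule (h⁻¹ * g) b := by
  classical
  have h1 := Y.mul_colinear (a ⊗ₜ b)
  have h2 := congrArg (fun t => TensorProduct.lid K A ((coeffAt K g).rTensor A t)) h1
  simp only [tensorCoact, LinearMap.comp_apply, TensorProduct.map_tmul, coact_eq_sum Y.toYDModule a,
    coact_eq_sum Y.toYDModule b, TensorProduct.sum_tmul, TensorProduct.tmul_sum, map_sum,
    LinearEquiv.coe_coe, TensorProduct.tensorTensorTensorComm_tmul, LinearMap.rTensor_tmul,
    LinearMap.lTensor_tmul, LinearMap.mul'_apply, MonoidAlgebra.single_mul_single, mul_one,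
    coeffAt_single, TensorProduct.lid_tmul, ite_smul, one_smul, zero_smul,
    ← eq_inv_mul_iff_mul_eq] at h2
  refine Eq.trans h2 ?_
  rw [Finset.sum_comm]
  simp

theorem psi_map_mul [Fintype G] (γ : G →* Kˣ) (a b : A) :
    psi Y.toYDModule γ (a * b) = psi Y.toYDModule γ a * psi Y.toYDModule γ b := by
  simp only [psi_eq_sum, proj_map_mul, Finset.smul_sum, Finset.sum_mul_sum]
  rw [Finset.sum_comm]
  refine Finset.sum_congr rfl fun h _ => ?_
  rw [← Equiv.sum_comp (Equiv.mulLeft h)]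
  simp [mul_smul_mul_comm]

theorem antipode_proj [Fintype G] (g : G) (a : A) :
    Y.antipode (proj Y.toYDModule g a) = proj Y.toYDModule g (Y.antipode a) := by
  have h3 : proj Y.toYDModule g (Y.antipode a) = TensorProduct.lid K A ((coeffAt K g).rTensor A
      (Y.coact (Y.antipode a))) := rfl
  rw [h3, Y.antipode_colinear, coact_eq_sum Y.toYDModule a]
  simp only [map_sum, LinearMap.lTensor_tmul]
  rw [← map_sum, ← map_sum, lid_coeffAt_sum]

end HopfAlgebra

/-! ### The braided tensor square, integrals and the antipode -/

section Braided

variable {K G A : Type*} [Field K] [CommGroup G] [Fintype G] [CommRing A] [Algebra K A]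

/-- Left multiplication by `a ⊗ 1` on the braided algebra `A ⊗̂ A`, i.e. `x ⊗ y ↦ a x ⊗ y`. -/
def leftOp (K A : Type*) [Field K] [CommRing A] [Algebra K A] :
    A →ₗ[K] Module.End K (A ⊗[K] A) :=
  LinearMap.rTensorHom A ∘ₗ LinearMap.mul K A

@[simp]
theorem leftOp_tmul (a x y : A) : leftOp K A a (x ⊗ₜ y) = (a * x) ⊗ₜ y := by
  simp [leftOp]

theorem leftOp_mul (a b : A) : leftOp K A (a * b) = leftOp K A a * leftOp K A b := by
  ext x y
  simp [mul_assoc]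

/-- Left multiplication by `1 ⊗ a` on the braided algebra `A ⊗̂ A`, i.e.
`x ⊗ y ↦ ∑ g, φ_g(x) ⊗ π_g(a) y`. -/
def rightOp (Y : YDModule K (MonoidAlgebra K G) A) : A →ₗ[K] Module.End K (A ⊗[K] A) :=
  ∑ g : G, TensorProduct.mapBilinear (RingHom.id K) A A A A (phi Y g) ∘ₗ LinearMap.mul K A ∘ₗ
    proj Y g

@[simp]
theorem rightOp_tmul (Y : YDModule K (MonoidAlgebra K G) A) (a x y : A) :
    rightOp Y a (x ⊗ₜ y) = ∑ g, phi Y g x ⊗ₜ (proj Y g a * y) := by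
  simp [rightOp]

theorem rightOp_proj_tmul (Y : YDModule K (MonoidAlgebra K G) A) (g : G) (a x y : A) :
    rightOp Y (proj Y g a) (x ⊗ₜ y) = phi Y g x ⊗ₜ (proj Y g a * y) := by
  classical
  rw [rightOp_tmul, Finset.sum_eq_single g]
  · simp [proj_proj]
  · intro h _ hh
    simp [proj_proj, hh.symm]
  · simp

/-- Left multiplication on the braided algebra `A ⊗̂ A`. -/
def braidedOp (Y : YDModule K (MonoidAlgebra K G) A) : A ⊗[K] A →ₗ[K] Module.End K (A ⊗[K] A) :=
  TensorProduct.lift ((LinearMap.mul K (Module.End K (A ⊗[K] A))).compl₁₂ (leftOp K A) (rightOp Y))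

@[simp]
theorem braidedOp_tmul (Y : YDModule K (MonoidAlgebra K G) A) (a b : A) :
    braidedOp Y (a ⊗ₜ b) = leftOp K A a * rightOp Y b := by
  simp [braidedOp]

theorem braidedMul_eq (Y : YDModule K (MonoidAlgebra K G) A) (s t : A ⊗[K] A) :
    braidedMul Y.act.toLinearMap Y.coact (s ⊗ₜ[K] t) = braidedOp Y s t := by
  suffices h : TensorProduct.curry (braidedMul Y.act.toLinearMap Y.coact) = braidedOp Y from
    LinearMap.congr_fun₂ h s t
  ext a b x y
  simp [braidedMul, quasisymmetry, coact_eq_sum Y b, TensorProduct.sum_tmul,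
    TensorProduct.tmul_sum, phi]

variable [Coalgebra K A] (Y : YDHopfAlgebra K (MonoidAlgebra K G) A)

local notation "φ" => phi Y.toYDModule
local notation "π" => proj Y.toYDModule
local notation "Δ" => Coalgebra.comul (R := K) (A := A)
local notation "ε" => Coalgebra.counit (R := K) (A := A)
local notation "S" => Y.antipode

theorem comul_mul_eq (a b : A) : Δ (a * b) = braidedOp Y.toYDModule (Δ a) (Δ b) := by
  rw [Y.comul_mul, braidedMul_eq]

theorem rightOp_mul (a b : A) :
    rightOp Y.toYDModule (a * b) = rightOp Y.toYDModule a * rightOp Y.toYDModule b := by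
  ext x y
  simp only [TensorProduct.AlgebraTensorModule.curry_apply, LinearMap.restrictScalars_self,
    TensorProduct.curry_apply, rightOp_tmul, proj_map_mul, Module.End.mul_apply, map_sum,
    Finset.sum_mul, TensorProduct.tmul_sum]
  rw [Finset.sum_comm]
  conv_rhs => rw [Finset.sum_comm]
  refine Finset.sum_congr rfl fun h _ => ?_
  rw [← Equiv.sum_comp (Equiv.mulLeft h)]
  simp [phi_mul, mul_assoc]

theorem rightOp_mul_leftOp (a b : A) :
    rightOp Y.toYDModule a * leftOp K A b =
      ∑ g, leftOp K A (φ g b) * rightOp Y.toYDModule (π g a) := by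
  ext x y
  simp only [TensorProduct.AlgebraTensorModule.curry_apply, LinearMap.restrictScalars_self,
    TensorProduct.curry_apply, Module.End.mul_apply, LinearMap.sum_apply, leftOp_tmul,
    rightOp_proj_tmul]
  simp [phi_map_mul]

/-- The identity `1 ⊗ a = (S(a₁) ⊗ 1) Δ(a₂)` in the braided algebra `A ⊗̂ A`, applied to the
coproduct of a left integral `Λ`, gives `(1 ⊗ a) Δ(Λ) = (S(a) ⊗ 1) Δ(Λ)`. -/
theorem rightOp_comul_integral {Λ : A} (hΛ : ∀ a, a * Λ = ε a • Λ) (a : A) :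
    rightOp Y.toYDModule a (Δ Λ) = leftOp K A (S a) (Δ Λ) := by
  let F : A ⊗[K] (A ⊗[K] A) →ₗ[K] Module.End K (A ⊗[K] A) :=
    TensorProduct.lift ((LinearMap.mul K (Module.End K (A ⊗[K] A))).compl₁₂
      (leftOp K A ∘ₗ S) (braidedOp Y.toYDModule))
  have h1 : F ((TensorProduct.assoc K A A A) ((Δ).rTensor A (Δ a))) = rightOp Y.toYDModule a := by
    have : F ∘ₗ (TensorProduct.assoc K A A A).toLinearMap ∘ₗ (Δ).rTensor A =
        rightOp Y.toYDModule ∘ₗ (TensorProduct.lid K A).toLinearMap ∘ₗ (ε).rTensor A := by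
      have h : F ∘ₗ (TensorProduct.assoc K A A A).toLinearMap =
          TensorProduct.lift ((LinearMap.mul K (Module.End K (A ⊗[K] A))).compl₁₂
          (leftOp K A ∘ₗ LinearMap.mul' K A ∘ₗ (S).rTensor A) (rightOp Y.toYDModule)) := by
        refine TensorProduct.ext_threefold fun x y z => ?_
        simp [F, leftOp_mul, mul_assoc]
      rw [← LinearMap.comp_assoc, h]
      refine TensorProduct.ext' fun x y => ?_
      simp only [LinearMap.comp_apply, LinearMap.rTensor_tmul, TensorProduct.lift.tmul,
        LinearMap.compl₁₂_apply, Y.mul_antipode_left, LinearEquiv.coe_coe, TensorProduct.lid_tmul]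
      ext u v
      simp [Algebra.algebraMap_eq_smul_one]
    have h2 := LinearMap.congr_fun this (Δ a)
    simpa using h2
  have h2 : ∀ t : A ⊗[K] A, F ((Δ).lTensor A t) (Δ Λ) =
      leftOp K A (S (TensorProduct.rid K A ((ε).lTensor A t))) (Δ Λ) := by
    intro t
    induction t with
    | zero => simp
    | add s t hs ht => simp [hs, ht]
    | tmul x y =>
      simp [F, ← comul_mul_eq, hΛ]
  rw [← h1, Coalgebra.coassoc_apply, h2]
  simp


omit [Fintype G] in
/-- The element `a` is recovered from `(a ⊗ 1) Δ(Λ)`, because `a Λ₁ S(Λ₂) = a`. -/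
theorem mul_antipode_leftOp_comul {Λ : A} (hΛ : ε Λ = 1) (a : A) :
    LinearMap.mul' K A ((S).lTensor A (leftOp K A a (Δ Λ))) = a := by
  have h : ∀ t : A ⊗[K] A, LinearMap.mul' K A ((S).lTensor A (leftOp K A a t)) =
      a * LinearMap.mul' K A ((S).lTensor A t) := by
    intro t
    induction t with
    | zero => simp
    | add s t hs ht => simp [hs, ht, mul_add]
    | tmul x y => simp [mul_assoc]
  rw [h, Y.mul_antipode_right, hΛ, map_one, mul_one]

/-- The antipode reverses products up to the quasisymmetry: `S(ab) = (a⁽¹⁾.S(b)) S(a⁽²⁾)`. The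
identity is tested on `Δ(Λ)` for a normalized integral `Λ`, where `S(a) ⊗ 1` and `1 ⊗ a` agree. -/
theorem antipode_mul {Λ : A} (hΛ : ∀ a, a * Λ = ε a • Λ) (hΛ' : ε Λ = 1) (a b : A) :
    S (a * b) = ∑ g, φ g (S b) * π g (S a) := by
  have h : leftOp K A (S (a * b)) (Δ Λ) = leftOp K A (∑ g, φ g (S b) * π g (S a)) (Δ Λ) := by
    rw [← rightOp_comul_integral Y hΛ, rightOp_mul, Module.End.mul_apply,
      rightOp_comul_integral Y hΛ, ← Module.End.mul_apply, rightOp_mul_leftOp]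
    simp [leftOp_mul, rightOp_comul_integral Y hΛ, antipode_proj]
  rw [← mul_antipode_leftOp_comul Y hΛ' (S (a * b)), h, mul_antipode_leftOp_comul Y hΛ']

/-- If `S(a) = 0` with `a` homogeneous, then `(1 ⊗ a) Δ(Λ) = 0`. Undoing the action on the first
factor and applying `S(x) y` to `x ⊗ y` gives `a S(Λ₁) Λ₂ = a = 0`. -/
theorem antipode_injective {Λ : A} (hΛ : ∀ a, a * Λ = ε a • Λ) (hΛ' : ε Λ = 1) :
    Function.Injective S := by
  rw [← LinearMap.ker_eq_bot, LinearMap.ker_eq_bot']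
  intro a ha
  have hπ : ∀ g, π g a = 0 := by
    intro g
    have h1 := rightOp_comul_integral Y hΛ (π g a)
    rw [antipode_proj, ha, map_zero, map_zero, LinearMap.zero_apply] at h1
    have h2 : ∀ t : A ⊗[K] A, LinearMap.mul' K A (TensorProduct.map (S ∘ₗ φ g⁻¹) LinearMap.id
        (rightOp Y.toYDModule (π g a) t)) = π g a * LinearMap.mul' K A ((S).rTensor A t) := by
      intro t
      induction t with
      | zero => simp
      | add s t hs ht => rw [map_add, map_add, map_add, hs, ht, map_add, map_add, mul_add]
      | tmul x y =>
        rw [rightOp_proj_tmul]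
        simp only [TensorProduct.map_tmul, LinearMap.comp_apply, phi_inv_apply, LinearMap.id_apply,
          LinearMap.mul'_apply, LinearMap.rTensor_tmul]
        ring
    have h3 := h2 (Δ Λ)
    rw [h1, map_zero, map_zero, Y.mul_antipode_left, hΛ', map_one, mul_one] at h3
    exact h3.symm
  rw [← sum_proj Y.toYDModule a]
  simp [hπ]

include Y in
/-- A Yetter-Drinfel'd Hopf algebra with a normalized integral `Λ` is finite-dimensional: the
second tensor factors of `Δ(Λ)` span an ideal that contains `1 = S(Λ₁) Λ₂`. -/
theorem finiteDimensional_of_integral {Λ : A} (hΛ : ∀ a, a * Λ = ε a • Λ) (hΛ' : ε Λ = 1) :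
    FiniteDimensional K A := by
  let E : Module.Dual K A →ₗ[K] A :=
    { toFun := fun f => TensorProduct.lid K A (f.rTensor A (Δ Λ))
      map_add' := by intro f g; simp [LinearMap.rTensor_add]
      map_smul' := by intro c f; simp [LinearMap.rTensor_smul] }
  -- The range of `E` lies in the span of the second factors of any expression for `Δ(Λ)`.
  have hfin : (LinearMap.range E).FG := by
    obtain ⟨s, hs⟩ := TensorProduct.exists_finset (Δ Λ)
    have hle : LinearMap.range E ≤
        Submodule.span K ((fun p : A × A => p.2) '' (s : Set (A × A))) := by
      rintro _ ⟨f, rfl⟩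
      change TensorProduct.lid K A (f.rTensor A (Δ Λ)) ∈ _
      rw [hs, map_sum, map_sum]
      refine Submodule.sum_mem _ fun p hp => ?_
      simp only [LinearMap.rTensor_tmul, TensorProduct.lid_tmul]
      exact Submodule.smul_mem _ _ (Submodule.subset_span ⟨p, hp, rfl⟩)
    have : FiniteDimensional K (Submodule.span K ((fun p : A × A => p.2) '' (s : Set (A × A)))) :=
      FiniteDimensional.span_of_finite K (s.finite_toSet.image _)
    exact (Submodule.fg_top _).mp
      (Submodule.finiteDimensional_of_le hle).fg_top
  -- The range is an ideal, because `(1 ⊗ a) Δ(Λ) = (S(a) ⊗ 1) Δ(Λ)`.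
  have hhom : ∀ (g : G) (a : A) (f : Module.Dual K A), π g a * E f ∈ LinearMap.range E := by
    intro g a f
    refine ⟨f ∘ₗ φ g⁻¹ ∘ₗ LinearMap.mul K A (S (π g a)), ?_⟩
    have h1 : ∀ t : A ⊗[K] A, TensorProduct.lid K A
        ((f ∘ₗ φ g⁻¹ ∘ₗ LinearMap.mul K A (S (π g a))).rTensor A t) =
        TensorProduct.lid K A ((f ∘ₗ φ g⁻¹).rTensor A (leftOp K A (S (π g a)) t)) := by
      intro t
      induction t with
      | zero => simp
      | add s t hs ht => simp only [map_add, hs, ht]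
      | tmul x y => simp
    have h2 : ∀ t : A ⊗[K] A, TensorProduct.lid K A ((f ∘ₗ φ g⁻¹).rTensor A
        (rightOp Y.toYDModule (π g a) t)) = π g a * TensorProduct.lid K A (f.rTensor A t) := by
      intro t
      induction t with
      | zero => simp
      | add s t hs ht => simp only [map_add, hs, ht, mul_add]
      | tmul x y =>
        rw [rightOp_proj_tmul]
        simp [phi_inv_apply]
    change TensorProduct.lid K A (_ : K ⊗[K] A) = _
    rw [h1, ← rightOp_comul_integral Y hΛ, h2]
    rfl
  have hmul : ∀ a x : A, x ∈ LinearMap.range E → a * x ∈ LinearMap.range E := by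
    rintro a _ ⟨f, rfl⟩
    rw [← sum_proj Y.toYDModule a, Finset.sum_mul]
    exact Submodule.sum_mem _ fun g _ => hhom g a f
  have hone : (1 : A) ∈ LinearMap.range E := by
    let ℬ := Module.Free.chooseBasis K A
    obtain ⟨c, hc⟩ := TensorProduct.eq_repr_basis_left ℬ (Δ Λ)
    have hcE : ∀ i, c i ∈ LinearMap.range E := by
      intro i
      refine ⟨ℬ.coord i, ?_⟩
      change TensorProduct.lid K A ((ℬ.coord i).rTensor A (Δ Λ)) = _
      rw [← hc]
      simp [Finsupp.sum, Finsupp.single_apply, ite_smul, eq_comm]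
    have h1 := Y.mul_antipode_left Λ
    rw [hΛ', map_one, ← hc] at h1
    rw [← h1]
    simp only [Finsupp.sum, map_sum, LinearMap.rTensor_tmul, LinearMap.mul'_apply]
    exact Submodule.sum_mem _ fun i _ => hmul _ _ (hcE i)
  have htop : LinearMap.range E = ⊤ := by
    rw [eq_top_iff]
    intro a _
    simpa using hmul a 1 hone
  rw [htop] at hfin
  exact ⟨hfin⟩

omit [Fintype G] in
include Y in
/-- A commutative semisimple algebra with a character `ε` contains a normalized integral: the
idempotent complementary to the generator of the kernel of `ε`. -/
theorem exists_integral [IsSemisimpleRing A] :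
    ∃ Λ : A, (∀ a, a * Λ = ε a • Λ) ∧ ε Λ = 1 := by
  let εR : A →+* K :=
    { toFun := ε
      map_one' := Y.counit_one
      map_mul' := Y.counit_mul
      map_zero' := map_zero _
      map_add' := map_add _ }
  obtain ⟨f, hf, hker⟩ := IsSemisimpleRing.ideal_eq_span_idempotent (RingHom.ker εR)
  have hfk : ε f = 0 := by
    have : f ∈ RingHom.ker εR := hker ▸ Ideal.mem_span_singleton_self f
    exact this
  refine ⟨1 - f, fun a => ?_, by rw [map_sub, Y.counit_one, hfk, sub_zero]⟩
  have hmem : a - algebraMap K A (ε a) ∈ RingHom.ker εR := by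
    change ε (a - algebraMap K A (ε a)) = 0
    rw [Algebra.algebraMap_eq_smul_one, map_sub, map_smul, Y.counit_one]
    simp
  rw [hker, Ideal.mem_span_singleton'] at hmem
  obtain ⟨c, hc⟩ := hmem
  have h0 : (a - algebraMap K A (ε a)) * (1 - f) = 0 := by
    rw [← hc, mul_assoc, mul_sub, mul_one, hf.eq, sub_self, mul_zero]
  rw [sub_mul, sub_eq_zero] at h0
  rw [h0, Algebra.smul_def]

/-- On a commutative semisimple Yetter-Drinfel'd Hopf algebra, the product twisted by the
quasisymmetry, `(a, b) ↦ (a⁽¹⁾.b) a⁽²⁾`, is commutative: the antipode is bijective and carries the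
given product to the twisted one. -/
theorem twisted_mul_comm [IsSemisimpleRing A] (a b : A) :
    ∑ g, φ g b * π g a = ∑ g, φ g a * π g b := by
  obtain ⟨Λ, hΛ, hΛ'⟩ := exists_integral Y
  have := finiteDimensional_of_integral Y hΛ hΛ'
  have hS := LinearMap.injective_iff_surjective.mp (antipode_injective Y hΛ hΛ')
  obtain ⟨a, rfl⟩ := hS a
  obtain ⟨b, rfl⟩ := hS b
  rw [← antipode_mul Y hΛ hΛ', ← antipode_mul Y hΛ hΛ', mul_comm]

end Braided

/-! ### Orthogonality relations for characters -/

section Characters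

variable {K G : Type*} [Field K] [CommGroup G]

/-- Orthogonality relation: a character summed over a subgroup `T` gives `|T|` or `0`, according
to whether or not it is trivial on `T`. -/
theorem sum_char_subgroup {X : Type*} [Group X] [Fintype X] (T : Subgroup X) [DecidablePred (· ∈ T)]
    (f : X →* Kˣ) [Decidable (∀ x ∈ T, f x = 1)] :
    ∑ x, (if x ∈ T then (f x : K) else 0) =
      if ∀ x ∈ T, f x = 1 then (Nat.card T : K) else 0 := by
  classical
  rw [← Finset.sum_filter, ← Finset.sum_subtype_eq_sum_filter, Finset.subtype_univ]
  have h := sum_hom_units ((Units.coeHom K).comp (f.comp T.subtype))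
  have hiff : (Units.coeHom K).comp (f.comp T.subtype) = 1 ↔ ∀ x ∈ T, f x = 1 := by
    simp [DFunLike.ext_iff]
  simp only [hiff] at h
  rw [Nat.card_eq_fintype_card]
  simpa using h

theorem sum_char_inv_subgroup [Fintype G] (T : Subgroup G) [DecidablePred (· ∈ T)]
    (γ : G →* Kˣ) [Decidable (γ ∈ charPerp K T)] :
    ∑ g, (if g ∈ T then ((γ g)⁻¹ : K) else 0) =
      if γ ∈ charPerp K T then (Nat.card T : K) else 0 := by
  classical
  have h := sum_char_subgroup (K := K) T γ⁻¹
  have hiff : (∀ g ∈ T, γ⁻¹ g = 1) ↔ γ ∈ charPerp K T := by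
    simp only [MonoidHom.inv_apply, inv_eq_one]
    rfl
  simp only [hiff] at h
  simpa using h

theorem sum_char_inv_dual [Fintype (G →* Kˣ)] (Q : Subgroup (G →* Kˣ)) [DecidablePred (· ∈ Q)]
    (g : G) [Decidable (g ∈ groupPerp Q)] :
    ∑ γ : G →* Kˣ, (if γ ∈ Q then ((γ g)⁻¹ : K) else 0) =
      if g ∈ groupPerp Q then (Nat.card Q : K) else 0 := by
  classical
  have h := sum_char_subgroup (K := K) Q (MonoidHom.eval g⁻¹)
  have hiff : (∀ γ ∈ Q, MonoidHom.eval g⁻¹ γ = 1) ↔ g ∈ groupPerp Q := by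
    refine forall₂_congr fun γ _ => ?_
    rw [MonoidHom.eval_apply_apply, map_inv, inv_eq_one]
  simp only [hiff] at h
  simpa using h

/-- The sum of `γ(g)⁻¹` over `T × Q` is `|Q| |T ∩ Q^⊥|`, hence nonzero in characteristic `0`. -/
theorem sum_sum_char_inv_ne_zero [CharZero K] [Fintype G] [Fintype (G →* Kˣ)] (T : Subgroup G)
    (Q : Subgroup (G →* Kˣ)) [DecidablePred (· ∈ T)] [DecidablePred (· ∈ Q)] :
    ∑ g, ∑ γ : G →* Kˣ, (if g ∈ T then if γ ∈ Q then ((γ g)⁻¹ : K) else 0 else 0) ≠ 0 := by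
  classical
  have h : ∀ g : G, ∑ γ : G →* Kˣ, (if g ∈ T then if γ ∈ Q then ((γ g)⁻¹ : K) else 0 else 0) =
      if g ∈ T ∧ g ∈ groupPerp Q then (Nat.card Q : K) else 0 := by
    intro g
    by_cases hg : g ∈ T
    · simp only [hg, if_true, true_and]
      exact sum_char_inv_dual Q g
    · simp [hg]
  rw [Finset.sum_congr rfl fun g _ => h g, ← Finset.sum_filter, Finset.sum_const, nsmul_eq_mul]
  refine mul_ne_zero (Nat.cast_ne_zero.mpr (Finset.card_ne_zero.mpr ⟨1, ?_⟩))
    (Nat.cast_ne_zero.mpr Nat.card_pos.ne')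
  simp [T.one_mem, (groupPerp Q).one_mem]

variable [IsAlgClosed K] [CharZero K]

theorem sum_char_inv_mul [Fintype G] [Fintype (G →* Kˣ)] [DecidableEq G] (g h : G) :
    ∑ γ : G →* Kˣ, ((γ g)⁻¹ * γ h : K) = if h = g then (Fintype.card (G →* Kˣ) : K) else 0 := by
  classical
  have : HasEnoughRootsOfUnity K (Monoid.exponent G) := by
    have : NeZero (Monoid.exponent G) := ⟨Monoid.exponent_ne_zero_of_finite⟩
    have : NeZero ((Monoid.exponent G : ℕ) : K) := NeZero.charZero
    infer_instance
  have h1 := sum_char_subgroup (K := K) (⊤ : Subgroup (G →* Kˣ)) (MonoidHom.eval (g⁻¹ * h))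
  simp only [Subgroup.mem_top, if_true, forall_true_left, MonoidHom.eval_apply_apply] at h1
  have hiff : (∀ γ : G →* Kˣ, γ (g⁻¹ * h) = 1) ↔ h = g := by
    rw [← CommGroup.forall_apply_eq_apply_iff (M := K) G (g := h) (g' := g)]
    refine forall_congr' fun γ => ?_
    rw [map_mul, map_inv, inv_mul_eq_one, eq_comm]
  simp only [hiff] at h1
  simpa using h1

end Characters

/-! ### Primitive idempotents -/

section Idempotents

variable {A : Type*} [CommRing A]

theorem IsPrimitiveIdempotent.eq_of_mul_ne_zero {e f : A} (he : IsPrimitiveIdempotent e)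
    (hf : IsPrimitiveIdempotent f) (h : e * f ≠ 0) : e = f := by
  have key : ∀ {e f : A}, IsPrimitiveIdempotent e → IsPrimitiveIdempotent f → e * f ≠ 0 →
      e = e * f := by
    intro e f he hf h
    have he' : e * e = e := he.2.1
    have hf' : f * f = f := hf.2.1
    rcases he.2.2 (e * f) (e * (1 - f)) (he.2.1.mul hf.2.1) (he.2.1.mul hf.2.1.one_sub)
      (by linear_combination -(e * e) * hf') (by linear_combination -(e * e) * hf') (by ring)
      with h0 | h0
    · exact absurd h0 h
    · linear_combination h0
  rw [key he hf h]
  nth_rw 2 [key hf he (by rwa [mul_comm])]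
  exact mul_comm _ _

/-- A bijection that preserves products, with additive inverse `g`, preserves primitive
idempotents. -/
theorem IsPrimitiveIdempotent.map {e : A} (he : IsPrimitiveIdempotent e) (f g : A → A)
    (hf : ∀ a b, f (a * b) = f a * f b) (hg : ∀ a b, g (a * b) = g a * g b)
    (hg_add : ∀ a b, g (a + b) = g a + g b) (hg0 : g 0 = 0) (hf0 : f 0 = 0)
    (hgf : ∀ a, g (f a) = a) (hfg : ∀ a, f (g a) = a) : IsPrimitiveIdempotent (f e) := by
  refine ⟨fun h => he.1 ?_, ?_, fun p q hp hq hpq hqp h => ?_⟩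
  · rw [← hgf e, h, hg0]
  · change f e * f e = f e
    rw [← hf, he.2.1.eq]
  · have hp' : IsIdempotentElem (g p) := by change g p * g p = g p; rw [← hg, hp.eq]
    have hq' : IsIdempotentElem (g q) := by change g q * g q = g q; rw [← hg, hq.eq]
    have := he.2.2 (g p) (g q) hp' hq' (by rw [← hg, hpq, hg0]) (by rw [← hg, hqp, hg0])
      (by rw [← hg_add, ← h, hgf])
    rcases this with h0 | h0
    · left; rw [← hfg p, h0, hf0]
    · right; rw [← hfg q, h0, hf0]

end Idempotents

/-! ### Orbits of a primitive idempotent -/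

section Orbits

variable {K G A : Type*} [Field K] [CommGroup G] [Fintype G]
  [CommRing A] [Algebra K A] [Coalgebra K A] (Y : YDHopfAlgebra K (MonoidAlgebra K G) A)

local notation "φ" => phi Y.toYDModule
local notation "π" => proj Y.toYDModule
local notation "ψ" => psi Y.toYDModule

omit [Fintype G] in
theorem IsPrimitiveIdempotent.phi {e : A} (he : IsPrimitiveIdempotent e) (g : G) :
    IsPrimitiveIdempotent (φ g e) :=
  he.map _ (φ g⁻¹) (phi_map_mul Y g) (phi_map_mul Y g⁻¹) (map_add _) (map_zero _) (map_zero _)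
    (phi_inv_apply _ g) (phi_apply_inv _ g)

theorem IsPrimitiveIdempotent.psi {e : A} (he : IsPrimitiveIdempotent e) (γ : G →* Kˣ) :
    IsPrimitiveIdempotent (ψ γ e) :=
  he.map _ (ψ γ⁻¹) (psi_map_mul Y γ) (psi_map_mul Y γ⁻¹) (map_add _) (map_zero _) (map_zero _)
    (psi_inv_apply _ γ) (psi_apply_inv _ γ)

omit [Fintype G] in
theorem mul_phi_eq_ite {e : A} (he : IsPrimitiveIdempotent e) (g : G)
    [Decidable (g ∈ inertiaGroup Y.toYDModule e)] :
    e * φ g e = if g ∈ inertiaGroup Y.toYDModule e then e else 0 := by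
  split_ifs with h
  · rw [show φ g e = e from h, he.2.1.eq]
  · by_contra h0
    exact h (he.eq_of_mul_ne_zero (he.phi Y g) h0).symm

theorem mul_psi_eq_ite {e : A} (he : IsPrimitiveIdempotent e) (γ : G →* Kˣ)
    [Decidable (γ ∈ isotropyGroup Y.toYDModule e)] :
    e * ψ γ e = if γ ∈ isotropyGroup Y.toYDModule e then e else 0 := by
  split_ifs with h
  · rw [show ψ γ e = e from h, he.2.1.eq]
  · by_contra h0
    exact h (he.eq_of_mul_ne_zero (he.psi Y γ) h0).symm

variable [IsAlgClosed K] [CharZero K]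

/-- Fourier inversion: the projection `π_g` is recovered from the operators `ψ_γ`. -/
theorem card_smul_proj [Fintype (G →* Kˣ)] (g : G) (a : A) :
    (Fintype.card (G →* Kˣ) : K) • π g a = ∑ γ : G →* Kˣ, ((γ g)⁻¹ : K) • ψ γ a := by
  classical
  simp only [psi_eq_sum, Finset.smul_sum, smul_smul]
  rw [Finset.sum_comm]
  have h : ∀ h : G, ∑ γ : G →* Kˣ, ((γ g)⁻¹ * γ h : K) • π h a =
      if h = g then (Fintype.card (G →* Kˣ) : K) • π h a else 0 := by
    intro h
    rw [← Finset.sum_smul]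
    have := sum_char_inv_mul (K := K) g h
    simp only [Units.val_inv_eq_inv_val] at this ⊢
    rw [this, ite_smul, zero_smul]
  simp only [Units.val_inv_eq_inv_val] at h ⊢
  simp [h]

variable [IsSemisimpleRing A]

/-- Commutativity of the twisted product `(a⁽¹⁾.b) a⁽²⁾`, after expanding the homogeneous
components `π_g` through the characters of `G`. -/
theorem sum_sum_phi_mul_psi_comm [Fintype (G →* Kˣ)] (a b : A) :
    ∑ g, ∑ γ : G →* Kˣ, ((γ g)⁻¹ : K) • (φ g b * ψ γ a) =
      ∑ g, ∑ γ : G →* Kˣ, ((γ g)⁻¹ : K) • (φ g a * ψ γ b) := by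
  have h := congrArg (fun x => (Fintype.card (G →* Kˣ) : K) • x) (twisted_mul_comm Y a b)
  simpa only [Finset.smul_sum, ← mul_smul_comm, card_smul_proj, Finset.mul_sum] using h

/-- For `k ∈ Q^⊥`, the twisted products of `e` and `φ_k(e)` are compared at `e`. In one order, the
coefficient is `|Q| |T ∩ Q^⊥| ≠ 0`; in the other, only those `γ ∈ T^⊥` contribute for which
`ψ_γ(φ_k(e)) = e`. -/
theorem exists_psi_eq_phi [Finite (G →* Kˣ)] {e : A} (he : IsPrimitiveIdempotent e) {k : G}
    (hk : k ∈ groupPerp (isotropyGroup Y.toYDModule e)) :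
    ∃ γ ∈ charPerp K (inertiaGroup Y.toYDModule e), φ k e = ψ γ e := by
  classical
  cases nonempty_fintype (G →* Kˣ)
  have hee : e * e = e := he.2.1
  by_contra! hcon
  have h0 : ∀ γ ∈ charPerp K (inertiaGroup Y.toYDModule e), e * ψ γ (φ k e) = 0 := by
    intro γ hγ
    by_contra hne
    refine hcon γ⁻¹ (inv_mem hγ) ?_
    nth_rw 2 [he.eq_of_mul_ne_zero ((he.phi Y k).psi Y γ) hne]
    exact (psi_inv_apply _ γ _).symm
  have h := congrArg (e * ·) (sum_sum_phi_mul_psi_comm Y e (φ k e))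
  simp only [Finset.mul_sum, mul_smul_comm] at h
  have hsplit : ∀ x y : A, e * (x * y) = (e * x) * (e * y) := by
    intro x y
    linear_combination -(x * y) * hee
  simp only [hsplit] at h
  -- On the left, replace `g` by `g k⁻¹`, so that `φ_g φ_k` becomes `φ_g`.
  rw [← Equiv.sum_comp (Equiv.mulRight k⁻¹)] at h
  simp only [Equiv.coe_mulRight, ← Module.End.mul_apply, ← phi_mul, inv_mul_cancel_right] at h
  simp only [Module.End.mul_apply, mul_phi_eq_ite Y he, mul_psi_eq_ite Y he] at h
  refine sum_sum_char_inv_ne_zero (K := K) (inertiaGroup Y.toYDModule e)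
    (isotropyGroup Y.toYDModule e) ((smul_eq_zero.mp ?_).resolve_right he.1)
  refine Eq.trans ?_ (h.trans ?_)
  · simp only [Finset.sum_smul]
    refine Finset.sum_congr rfl fun g _ => Finset.sum_congr rfl fun γ _ => ?_
    by_cases hg : g ∈ inertiaGroup Y.toYDModule e <;>
      by_cases hγ : γ ∈ isotropyGroup Y.toYDModule e <;> simp [hg, hγ, hee]
    rw [hk γ hγ]
    simp
  · rw [Finset.sum_comm]
    refine Finset.sum_eq_zero fun γ _ => ?_
    have h1 := sum_char_inv_subgroup (K := K) (inertiaGroup Y.toYDModule e) γ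
    have h2 : ∀ g : G, ((γ g)⁻¹ : K) • ((if g ∈ inertiaGroup Y.toYDModule e then e else 0) *
        (e * ψ γ (φ k e))) = (if g ∈ inertiaGroup Y.toYDModule e then ((γ g)⁻¹ : K) else 0) •
          (e * ψ γ (φ k e)) := by
      intro g
      split_ifs
      · rw [← mul_assoc, hee]
      · simp
    rw [Finset.sum_congr rfl fun g _ => h2 g, ← Finset.sum_smul, h1]
    split_ifs with hγ
    · rw [h0 γ hγ, smul_zero]
    · rw [zero_smul]

/-- For `κ ∈ T^⊥`, the twisted products of `e` and `ψ_κ(e)` are compared at `e`. In one order, the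
coefficient is `|Q| |T ∩ Q^⊥| ≠ 0`; in the other, only those `g ∈ Q^⊥` contribute for which
`φ_g(ψ_κ(e)) = e`. -/
theorem exists_phi_eq_psi [Finite (G →* Kˣ)] {e : A} (he : IsPrimitiveIdempotent e) {κ : G →* Kˣ}
    (hκ : κ ∈ charPerp K (inertiaGroup Y.toYDModule e)) :
    ∃ g ∈ groupPerp (isotropyGroup Y.toYDModule e), ψ κ e = φ g e := by
  classical
  cases nonempty_fintype (G →* Kˣ)
  have hee : e * e = e := he.2.1
  by_contra! hcon
  have h0 : ∀ g ∈ groupPerp (isotropyGroup Y.toYDModule e), e * φ g (ψ κ e) = 0 := by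
    intro g hg
    by_contra hne
    refine hcon g⁻¹ (inv_mem hg) ?_
    nth_rw 2 [he.eq_of_mul_ne_zero ((he.psi Y κ).phi Y g) hne]
    exact (phi_inv_apply _ g _).symm
  have h := congrArg (e * ·) (sum_sum_phi_mul_psi_comm Y (ψ κ e) e)
  simp only [Finset.mul_sum, mul_smul_comm] at h
  have hsplit : ∀ x y : A, e * (x * y) = (e * x) * (e * y) := by
    intro x y
    linear_combination -(x * y) * hee
  simp only [hsplit] at h
  -- On the left, replace `γ` by `γ κ⁻¹`, so that `ψ_γ ψ_κ` becomes `ψ_γ`.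
  have hshift : ∀ F : (G →* Kˣ) → A, ∑ γ, F γ = ∑ γ, F (γ * κ⁻¹) := fun F =>
    (Equiv.sum_comp (Equiv.mulRight κ⁻¹) F).symm
  have hψ : ∀ γ : G →* Kˣ, ψ (γ * κ⁻¹) (ψ κ e) = ψ γ e := by
    intro γ
    rw [psi_mul, Module.End.mul_apply, psi_inv_apply]
  conv_lhs at h =>
    enter [2, g]
    rw [hshift]
  simp only [hψ, mul_phi_eq_ite Y he, mul_psi_eq_ite Y he] at h
  refine sum_sum_char_inv_ne_zero (K := K) (inertiaGroup Y.toYDModule e)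
    (isotropyGroup Y.toYDModule e) ((smul_eq_zero.mp ?_).resolve_right he.1)
  refine Eq.trans ?_ (h.trans ?_)
  · simp only [Finset.sum_smul]
    refine Finset.sum_congr rfl fun g _ => Finset.sum_congr rfl fun γ _ => ?_
    by_cases hg : g ∈ inertiaGroup Y.toYDModule e <;>
      by_cases hγ : γ ∈ isotropyGroup Y.toYDModule e <;> simp [hg, hγ, hee]
    rw [hκ g hg]
    simp
  · refine Finset.sum_eq_zero fun g _ => ?_
    have h1 := sum_char_inv_dual (K := K) (isotropyGroup Y.toYDModule e) g
    have h2 : ∀ γ : G →* Kˣ, ((γ g)⁻¹ : K) • ((e * φ g (ψ κ e)) *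
        (if γ ∈ isotropyGroup Y.toYDModule e then e else 0)) =
        (if γ ∈ isotropyGroup Y.toYDModule e then ((γ g)⁻¹ : K) else 0) •
          (e * φ g (ψ κ e)) := by
      intro γ
      split_ifs
      · rw [mul_right_comm, hee]
      · simp
    rw [Finset.sum_congr rfl fun γ _ => h2 γ, ← Finset.sum_smul, h1]
    split_ifs with hg
    · rw [h0 g hg, smul_zero]
    · rw [zero_smul]

end Orbits
end YetterDrinfeld
end

theorem proposition3p5 {K G A : Type*} [Field K] [IsAlgClosed K] [CharZero K]
    [CommGroup G] [Finite G] [CommRing A] [Algebra K A] [Coalgebra K A] [IsSemisimpleRing A]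
    (Y : YetterDrinfeld.YDHopfAlgebra K (MonoidAlgebra K G) A)
    (e : A) (he : YetterDrinfeld.IsPrimitiveIdempotent e) :
    {a : A | ∃ g ∈ YetterDrinfeld.groupPerp (YetterDrinfeld.isotropyGroup Y.toYDModule e),
        a = YetterDrinfeld.phi Y.toYDModule g e} =
      {a : A | ∃ γ ∈ YetterDrinfeld.charPerp K (YetterDrinfeld.inertiaGroup Y.toYDModule e),
        a = YetterDrinfeld.psi Y.toYDModule γ e} := by
  cases nonempty_fintype G
  ext a
  constructor
  · rintro ⟨g, hg, rfl⟩
    exact YetterDrinfeld.exists_psi_eq_phi Y he hg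
  · rintro ⟨γ, hγ, rfl⟩
    exact YetterDrinfeld.exists_phi_eq_psi Y he hγ
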